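/- Let $\mathbb D$ be the open unit disc, let $H^2$ be the Hardy space of analytic functions on $\mathbb D$ with square summable Taylor coefficients, and let $b$ be a function in the closed unit ball of $H^\infty$ (that is, $b$ is analytic on $\mathbb D$ with $|b|\le 1$) which is not an extreme point of this ball. Let $H(b)$ be the de Branges–Rovnyak space of $b$: the range of $(I-T_bT_b^*)^{1/2}$ on $H^2$, where $T_bf=bf$, with the inner product determined by $$\langle (I-T_bT_b^*)^{1/2}f,\,(I-T_bT_b^*)^{1/2}g\rangle_b=\langle f,g\rangle_{H^2}\qquad\text{for } f,g\perp\ker (I-T_bT_b^*)^{1/2}.$$ Then multiplication by $z$ maps $H(b)$ into itself and defines a bounded operator $T$ on $H(b)$ (the restriction of the shift). The operator $T$ is completely hyperexpansive, i.e. $$\sum_{i=0}^{n}(-1)^i\binom ni\, T^{*i}T^i\le 0\qquad\text{for every } n\ge 1,$$ if and only if there are $c,\gamma,\beta\in\mathbb C$ with $|\beta|<1$ such that $$b(z)=\frac{c+\gamma z}{1-\beta z}\qquad\text{for all } z\in\mathbb D .$$ -/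

import Mathlib

open scoped Complex.UnitDisc ENNReal

/-! ### The Hardy space on the unit disc -/

/-- The Hardy space `H²` of the open unit disc, coordinatized by Taylor coefficients: the element
with coefficients `a ∈ ℓ²(ℕ)` is the analytic function `z ↦ ∑ aₙ zⁿ` on the disc
(see `HardySpace.toFun`), and the inner product is that of `ℓ²(ℕ)`. -/
abbrev HardySpace : Type := lp (fun _ : ℕ => ℂ) 2

namespace HardySpace

/-- The analytic function on the disc with the given Taylor coefficients. -/
noncomputable def toFun (f : HardySpace) (z : 𝔻) : ℂ := ∑' n, f n * (z : ℂ) ^ n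

theorem summable_norm_toFun (f : HardySpace) {r : ℝ} (h0 : 0 ≤ r) (h1 : r < 1) :
    Summable fun n => ‖f n‖ * r ^ n := by
  refine Summable.of_nonneg_of_le (fun n => by positivity) (fun n => ?_)
    ((summable_geometric_of_lt_one h0 h1).mul_left ‖f‖)
  exact mul_le_mul_of_nonneg_right (lp.norm_apply_le_norm (by norm_num) f n) (by positivity)

theorem hasSum_sq (f : HardySpace) : HasSum (fun n => ‖f n‖ ^ 2) (‖f‖ ^ 2) := by
  simpa using lp.hasSum_norm (p := 2) (by norm_num) f

/-- Parseval's identity on the circle of radius `r`. -/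
theorem parseval {a : ℕ → ℂ} {r : ℝ} (h0 : 0 ≤ r) (ha : Summable fun n => ‖a n‖ * r ^ n) :
    ∃ g : C(AddCircle (1 : ℝ), ℂ),
      (∀ t, g t = ∑' n, a n * ((r : ℂ) * (AddCircle.toCircle t : ℂ)) ^ n) ∧
      HasSum (fun n => (‖a n‖ * r ^ n) ^ 2)
        (‖ContinuousMap.toLp (E := ℂ) 2 AddCircle.haarAddCircle ℂ g‖ ^ 2) := by
  have hnorm : ∀ n : ℕ, ‖(a n * (r : ℂ) ^ n) • (fourier (T := (1 : ℝ)) (n : ℤ))‖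
      = ‖a n‖ * r ^ n := by
    intro n
    rw [norm_smul, fourier_norm, norm_mul, norm_pow, Complex.norm_real,
      Real.norm_of_nonneg h0, mul_one]
  have hs : Summable fun n : ℕ =>
      (a n * (r : ℂ) ^ n) • (fourier (T := (1 : ℝ)) (n : ℤ)) := by
    apply Summable.of_norm
    simpa only [hnorm] using ha
  refine ⟨∑' n : ℕ, (a n * (r : ℂ) ^ n) • (fourier (T := (1 : ℝ)) (n : ℤ)), ?_, ?_⟩
  · intro t
    refine ((ContinuousMap.evalCLM ℂ t).map_tsum hs).trans (tsum_congr fun n => ?_)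
    simp [fourier_apply, AddCircle.toCircle_nsmul, mul_pow, mul_assoc]
  · set v : ℕ → MeasureTheory.Lp ℂ 2 (@AddCircle.haarAddCircle (1 : ℝ) _) :=
      fun n => fourierLp 2 (n : ℤ) with hv
    have hvo : Orthonormal ℂ v := orthonormal_fourier.comp _ Nat.cast_injective
    have hL := hs.hasSum.mapL
      (ContinuousMap.toLp (E := ℂ) 2 (@AddCircle.haarAddCircle (1 : ℝ) _) ℂ)
    simp only [map_smul] at hL
    have hsq : Summable fun n => ‖a n * (r : ℂ) ^ n‖ ^ (2 : ℝ≥0∞).toReal := by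
      have h2 : Summable fun n => (‖a n‖ * r ^ n) ^ 2 := by
        refine Summable.of_norm_bounded_eventually ha ?_
        rw [Nat.cofinite_eq_atTop]
        filter_upwards [ha.tendsto_atTop_zero.eventually (gt_mem_nhds one_pos)] with n hn
        have hp : 0 ≤ ‖a n‖ * r ^ n := by positivity
        rw [Real.norm_of_nonneg (by positivity)]
        nlinarith
      convert! h2 using 2 with n
      simp [abs_of_nonneg h0]
    let c : HardySpace := ⟨fun n => a n * (r : ℂ) ^ n, memℓp_gen hsq⟩
    have hc := hvo.orthogonalFamily.hasSum_linearIsometry c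
    have hEq : hvo.orthogonalFamily.linearIsometry c =
        ContinuousMap.toLp (E := ℂ) 2 (@AddCircle.haarAddCircle (1 : ℝ) _) ℂ
          (∑' n : ℕ, (a n * (r : ℂ) ^ n) • (fourier (T := (1 : ℝ)) (n : ℤ))) := by
      refine HasSum.unique hc ?_
      simpa [c, hv] using! hL
    rw [← hEq, LinearIsometry.norm_map]
    convert! hasSum_sq c using 2 with n
    simp [c, abs_of_nonneg h0]

theorem toFun_injective : Function.Injective toFun := by
  intro f g hfg
  have hs : Summable fun n => ‖(f - g) n‖ * (1 / 2 : ℝ) ^ n :=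
    summable_norm_toFun (f - g) (by norm_num) (by norm_num)
  obtain ⟨G, hG, hsum⟩ := parseval (by norm_num) hs
  have hG0 : G = 0 := by
    ext t
    have hz : ‖((1 / 2 : ℝ) : ℂ) * (AddCircle.toCircle t : ℂ)‖ = 1 / 2 := by
      rw [norm_mul, Circle.norm_coe, Complex.norm_real, mul_one]; norm_num
    have hz1 : ‖((1 / 2 : ℝ) : ℂ) * (AddCircle.toCircle t : ℂ)‖ < 1 := by rw [hz]; norm_num
    have key := congrFun hfg (Complex.UnitDisc.mk _ hz1)
    have hsm : ∀ h : HardySpace, Summable fun n =>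
        h n * (((1 / 2 : ℝ) : ℂ) * (AddCircle.toCircle t : ℂ)) ^ n := by
      intro h
      apply Summable.of_norm
      simp only [norm_mul (h _), norm_pow, hz]
      exact summable_norm_toFun h (by norm_num) (by norm_num)
    rw [hG]
    simp only [lp.coeFn_sub, Pi.sub_apply, sub_mul, ContinuousMap.zero_apply]
    rw [Summable.tsum_sub (hsm f) (hsm g), sub_eq_zero]
    exact key
  rw [hG0] at hsum
  simp only [map_zero, norm_zero, ne_eq, OfNat.ofNat_ne_zero, not_false_eq_true, zero_pow] at hsum
  have h0 := (hasSum_zero_iff_of_nonneg (fun n => by positivity)).1 hsum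
  ext n
  have := congrFun h0 n
  simpa [sub_eq_zero] using this

/-- `H²` consists of exactly the functions on the disc that are sums of power series with square
summable coefficients. -/
theorem exists_toFun_eq_iff (g : 𝔻 → ℂ) : (∃ f : HardySpace, f.toFun = g) ↔
    ∃ a : ℕ → ℂ, (Summable fun n => ‖a n‖ ^ 2) ∧
      ∀ z : 𝔻, HasSum (fun n => a n * (z : ℂ) ^ n) (g z) := by
  constructor
  · rintro ⟨f, rfl⟩
    refine ⟨fun n => f n, (hasSum_sq f).summable, fun z => Summable.hasSum ?_⟩
    apply Summable.of_norm
    simpa only [norm_mul, norm_pow] using summable_norm_toFun f (norm_nonneg _) z.norm_lt_one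
  · rintro ⟨a, ha, hg⟩
    exact ⟨⟨a, memℓp_gen (by simpa using ha)⟩, funext fun z => (hg z).tsum_eq⟩

end HardySpace

/-! ### The unit ball of `H^∞` and its Toeplitz operators -/

/-- The closed unit ball of `H^∞`: the analytic functions on the open unit disc with supremum norm
at most one, as a set of functions on the disc. -/
def hardyInftyUnitBall : Set (𝔻 → ℂ) :=
  {b | (∃ F : ℂ → ℂ, DifferentiableOn ℂ F (Metric.ball 0 1) ∧ ∀ z : 𝔻, b z = F z) ∧
    ∀ z : 𝔻, ‖b z‖ ≤ 1}

/-- Multiplication by a function of the unit ball of `H^∞` contracts the norm of `H²`. -/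
theorem HardySpace.exists_mul {b : 𝔻 → ℂ} (hb : b ∈ hardyInftyUnitBall) (f : HardySpace) :
    ∃ g : HardySpace, ‖g‖ ≤ ‖f‖ ∧ ∀ z, g.toFun z = b z * f.toFun z := by
  obtain ⟨⟨F, hF, hbF⟩, hb1⟩ := hb
  let β : ℕ → ℂ := fun n => ((n.factorial : ℂ))⁻¹ * iteratedDeriv n F 0
  have hβ : ∀ z : ℂ, ‖z‖ < 1 → HasSum (fun n => β n * z ^ n) (F z) := by
    intro z hz
    have := Complex.hasSum_taylorSeries_on_ball hF (z := z) (by simpa using hz)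
    convert! this using 2 with n
    simp [β]; ring
  have hβs : ∀ r : ℝ, 0 ≤ r → r < 1 → Summable fun n => ‖β n‖ * r ^ n := by
    intro r h0 h1
    have := (hβ (r : ℂ) (by simpa [abs_of_nonneg h0] using h1)).summable.norm
    simpa [abs_of_nonneg h0] using this
  let c : ℕ → ℂ := fun n => ∑ kl ∈ Finset.HasAntidiagonal.antidiagonal n, β kl.1 * f kl.2
  have hcz : ∀ z : ℂ, ∀ n, c n * z ^ n =
      ∑ kl ∈ Finset.HasAntidiagonal.antidiagonal n, (β kl.1 * z ^ kl.1) * (f kl.2 * z ^ kl.2) := by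
    intro z n
    simp only [c, Finset.sum_mul]
    refine Finset.sum_congr rfl fun kl hkl => ?_
    rw [← Finset.HasAntidiagonal.mem_antidiagonal.1 hkl, pow_add]; ring
  have hn : ∀ (a : ℕ → ℂ) (z : ℂ), (Summable fun n => ‖a n‖ * ‖z‖ ^ n) →
      Summable fun n => ‖a n * z ^ n‖ := by
    intro a z h
    simpa using h
  have hcs : ∀ r : ℝ, 0 ≤ r → r < 1 → Summable fun n => ‖c n‖ * r ^ n := by
    intro r h0 h1
    have hr : ‖(r : ℂ)‖ = r := by simp [abs_of_nonneg h0]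
    have := summable_norm_sum_mul_antidiagonal_of_summable_norm
      (hn β r (by rw [hr]; exact hβs r h0 h1))
      (hn (fun n => f n) r (by rw [hr]; exact HardySpace.summable_norm_toFun f h0 h1))
    simp only [← hcz] at this
    simpa [abs_of_nonneg h0] using this
  have hmul : ∀ z : ℂ, ‖z‖ < 1 → ∑' n, c n * z ^ n = F z * ∑' n, f n * z ^ n := by
    intro z hz
    rw [← (hβ z hz).tsum_eq, tsum_mul_tsum_eq_tsum_sum_antidiagonal_of_summable_norm
      (hn β z (hβs _ (norm_nonneg _) hz))
      (hn (fun n => f n) z (HardySpace.summable_norm_toFun f (norm_nonneg _) hz))]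
    exact tsum_congr (hcz z)
  have hbound : ∀ r : ℝ, 0 ≤ r → r < 1 → ∀ s : Finset ℕ,
      ∑ n ∈ s, (‖c n‖ * r ^ n) ^ 2 ≤ ‖f‖ ^ 2 := by
    intro r h0 h1 s
    obtain ⟨G, hG, hGs⟩ := HardySpace.parseval h0 (hcs r h0 h1)
    obtain ⟨K, hK, hKs⟩ := HardySpace.parseval h0 (HardySpace.summable_norm_toFun f h0 h1)
    have hle : ‖ContinuousMap.toLp (E := ℂ) 2 (@AddCircle.haarAddCircle (1 : ℝ) _) ℂ G‖ ≤
        ‖ContinuousMap.toLp (E := ℂ) 2 (@AddCircle.haarAddCircle (1 : ℝ) _) ℂ K‖ := by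
      apply MeasureTheory.Lp.norm_le_norm_of_ae_le
      filter_upwards [ContinuousMap.coeFn_toLp (p := 2) (𝕜 := ℂ) AddCircle.haarAddCircle G,
        ContinuousMap.coeFn_toLp (p := 2) (𝕜 := ℂ) AddCircle.haarAddCircle K] with t h3 h4
      rw [h3, h4, hG, hK]
      have hz : ‖(r : ℂ) * (AddCircle.toCircle t : ℂ)‖ < 1 := by
        rw [norm_mul, Circle.norm_coe, Complex.norm_real, Real.norm_of_nonneg h0, mul_one]
        exact h1
      rw [hmul _ hz, norm_mul]
      have h5 := hb1 (Complex.UnitDisc.mk _ hz)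
      rw [hbF] at h5
      exact mul_le_of_le_one_left (norm_nonneg _) h5
    calc ∑ n ∈ s, (‖c n‖ * r ^ n) ^ 2 ≤ _ := sum_le_hasSum s (fun n _ => by positivity) hGs
      _ ≤ _ := pow_le_pow_left₀ (norm_nonneg _) hle 2
      _ ≤ ‖f‖ ^ 2 := by
        refine hasSum_le (fun n => ?_) hKs (HardySpace.hasSum_sq f)
        refine pow_le_pow_left₀ (by positivity) ?_ 2
        exact mul_le_of_le_one_right (norm_nonneg _) (pow_le_one₀ h0 h1.le)
  have hfin : ∀ s : Finset ℕ, ∑ n ∈ s, ‖c n‖ ^ 2 ≤ ‖f‖ ^ 2 := by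
    intro s
    have hcont : Continuous fun r : ℝ => ∑ n ∈ s, (‖c n‖ * r ^ n) ^ 2 := by fun_prop
    have ht : Filter.Tendsto (fun r : ℝ => ∑ n ∈ s, (‖c n‖ * r ^ n) ^ 2)
        (nhdsWithin 1 (Set.Iio 1)) (nhds (∑ n ∈ s, ‖c n‖ ^ 2)) := by
      have := (hcont.tendsto 1).mono_left (nhdsWithin_le_nhds (s := Set.Iio 1))
      simpa using this
    refine le_of_tendsto ht ?_
    filter_upwards [Ioo_mem_nhdsLT (show (0 : ℝ) < 1 from one_pos)] with r hr
    exact hbound r hr.1.le hr.2 s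
  let g : HardySpace := ⟨c, memℓp_gen' (C := ‖f‖ ^ 2) (by simpa using hfin)⟩
  refine ⟨g, lp.norm_le_of_forall_sum_le (by norm_num) (norm_nonneg _) (by simpa [g] using hfin), ?_⟩
  intro z
  rw [hbF]
  exact hmul z z.norm_lt_one

theorem HardySpace.toFun_add (f g : HardySpace) : (f + g).toFun = f.toFun + g.toFun := by
  funext z
  have hsm : ∀ h : HardySpace, Summable fun n => h n * (z : ℂ) ^ n := fun h => by
    apply Summable.of_norm
    simpa only [norm_mul, norm_pow] using
      HardySpace.summable_norm_toFun h (norm_nonneg _) z.norm_lt_one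
  simp only [HardySpace.toFun, lp.coeFn_add, Pi.add_apply, add_mul]
  exact Summable.tsum_add (hsm f) (hsm g)

theorem HardySpace.toFun_smul (c : ℂ) (f : HardySpace) : (c • f).toFun = c • f.toFun := by
  funext z
  simp only [HardySpace.toFun, lp.coeFn_smul, Pi.smul_apply, smul_eq_mul, mul_assoc]
  exact tsum_mul_left

/-- The (analytic) Toeplitz operator `T_b f = b f` on `H²`. The Toeplitz operator with symbol the
conjugate of `b` is its adjoint. -/
noncomputable def toeplitz {b : 𝔻 → ℂ} (hb : b ∈ hardyInftyUnitBall) :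
    HardySpace →L[ℂ] HardySpace :=
  LinearMap.mkContinuous
    { toFun := fun f => (HardySpace.exists_mul hb f).choose
      map_add' := fun f g => HardySpace.toFun_injective <| by
        funext z
        refine ((HardySpace.exists_mul hb (f + g)).choose_spec.2 z).trans ?_
        rw [HardySpace.toFun_add (Exists.choose _), Pi.add_apply,
          (HardySpace.exists_mul hb f).choose_spec.2, (HardySpace.exists_mul hb g).choose_spec.2,
          HardySpace.toFun_add, Pi.add_apply, mul_add]
      map_smul' := fun c f => HardySpace.toFun_injective <| by
        funext z
        refine ((HardySpace.exists_mul hb (c • f)).choose_spec.2 z).trans ?_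
        rw [RingHom.id_apply, HardySpace.toFun_smul c (Exists.choose _), Pi.smul_apply,
          (HardySpace.exists_mul hb f).choose_spec.2, HardySpace.toFun_smul, Pi.smul_apply,
          smul_eq_mul, smul_eq_mul, mul_left_comm] }
    1 (fun f => by simpa using (HardySpace.exists_mul hb f).choose_spec.1)

theorem toeplitz_toFun {b : 𝔻 → ℂ} (hb : b ∈ hardyInftyUnitBall) (f : HardySpace) (z : 𝔻) :
    (toeplitz hb f).toFun z = b z * f.toFun z :=
  (HardySpace.exists_mul hb f).choose_spec.2 z

theorem norm_toeplitz_le {b : 𝔻 → ℂ} (hb : b ∈ hardyInftyUnitBall) : ‖toeplitz hb‖ ≤ 1 :=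
  LinearMap.mkContinuous_norm_le _ zero_le_one _

/-! ### Operator range spaces -/

section RangeSpace

variable {E : Type*} [NormedAddCommGroup E] [InnerProductSpace ℂ E] [CompleteSpace E]

/-- The range of a bounded operator `A` of a Hilbert space, to be given the inner product that
makes `A` a coisometry onto it (not the inner product of the ambient space). -/
def RangeSpace (A : E →L[ℂ] E) : Type _ := ↥(LinearMap.range (A : E →ₗ[ℂ] E))

namespace RangeSpace

variable (A : E →L[ℂ] E)

noncomputable instance : AddCommGroup (RangeSpace A) :=
  inferInstanceAs (AddCommGroup ↥(LinearMap.range (A : E →ₗ[ℂ] E)))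

noncomputable instance : Module ℂ (RangeSpace A) :=
  inferInstanceAs (Module ℂ ↥(LinearMap.range (A : E →ₗ[ℂ] E)))

variable {A} in
/-- An element of the range space as a vector of the ambient space. -/
def val (x : RangeSpace A) : E := Subtype.val x

instance : CompleteSpace ↥(LinearMap.ker (A : E →ₗ[ℂ] E)) :=
  A.isClosed_ker.completeSpace_coe

/-- The linear bijection sending `x` in the range of `A` to its unique preimage under `A` in the
orthogonal complement of the kernel of `A`. -/
noncomputable def lift : RangeSpace A ≃ₗ[ℂ] ↥(LinearMap.ker (A : E →ₗ[ℂ] E))ᗮ :=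
  (A : E →ₗ[ℂ] E).quotKerEquivRange.symm ≪≫ₗ
    Submodule.quotientEquivOfIsCompl _ _ (Submodule.isCompl_orthogonal _)

theorem apply_lift (x : RangeSpace A) : A (lift A x : E) = x.val := by
  obtain ⟨y, rfl⟩ := (lift A).symm.surjective x
  rw [LinearEquiv.apply_symm_apply]
  rfl

noncomputable instance : NormedAddCommGroup (RangeSpace A) :=
  NormedAddCommGroup.induced _ _ (lift A).toLinearMap (lift A).injective

/-- The inner product `⟪A f, A g⟫ = ⟪f, g⟫` for `f, g` orthogonal to the kernel of `A`. -/
noncomputable instance : InnerProductSpace ℂ (RangeSpace A) :=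
  InnerProductSpace.induced (lift A).toLinearMap

theorem inner_eq (x y : RangeSpace A) :
    inner ℂ x y = inner ℂ (lift A x : E) (lift A y : E) := rfl

instance : CompleteSpace (RangeSpace A) := by
  let e : RangeSpace A ≃ₗᵢ[ℂ] ↥(LinearMap.ker (A : E →ₗ[ℂ] E))ᗮ :=
    { lift A with norm_map' := fun _ => rfl }
  exact (completeSpace_congr (e := e.toEquiv) e.isometry.isUniformEmbedding).2 inferInstance

end RangeSpace

/-- The positive square root `(I - B B^*)^{1/2}`, for a contraction `B`. -/
noncomputable def defectRoot (B : E →L[ℂ] E) : E →L[ℂ] E :=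
  CFC.sqrt (1 - B * ContinuousLinearMap.adjoint B)

theorem defectRoot_spec {B : E →L[ℂ] E} (hB : ‖B‖ ≤ 1) :
    0 ≤ defectRoot B ∧ defectRoot B * defectRoot B = 1 - B * ContinuousLinearMap.adjoint B := by
  have h : 0 ≤ 1 - B * ContinuousLinearMap.adjoint B := by
    rw [sub_nonneg]
    refine (CStarAlgebra.norm_le_one_iff_of_nonneg _ (mul_star_self_nonneg B)).1 ?_
    rw [CStarRing.norm_self_mul_star]
    exact mul_le_one₀ hB (norm_nonneg _) hB
  exact ⟨CFC.sqrt_nonneg _, CFC.sqrt_mul_sqrt_self _ h⟩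

end RangeSpace

/-! ### de Branges-Rovnyak spaces and complete hyperexpansivity -/

/-- The de Branges-Rovnyak space `H(b)`: the range of `(I - T_b T_b^*)^{1/2}` on `H²`, with the
inner product of a range space. -/
noncomputable abbrev DeBrangesRovnyak {b : 𝔻 → ℂ} (hb : b ∈ hardyInftyUnitBall) : Type :=
  RangeSpace (defectRoot (toeplitz hb))

/-- A bounded operator `T` on a Hilbert space is completely hyperexpansive if
`∑_{i=0}^{n} (-1)^i (n choose i) (T^*)^i T^i ≤ 0` for all `n ≥ 1`. -/
def IsCompletelyHyperexpansive {E : Type*} [NormedAddCommGroup E] [InnerProductSpace ℂ E]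
    [CompleteSpace E] (T : E →L[ℂ] E) : Prop :=
  ∀ n : ℕ, 1 ≤ n →
    ∑ i ∈ Finset.range (n + 1),
      ((-1 : ℂ) ^ i * (n.choose i : ℂ)) • ((ContinuousLinearMap.adjoint T) ^ i * T ^ i) ≤ 0

/-! Write `S` for the shift on H², `B = T_b`, and `ι` for the inclusion of H(b), so that `ι ι* = 1 -
B B*`. Non-extremality puts `b` itself in H(b), say `b = ι p`: if `b = s b₁ + t b₂` properly, then
`G = √(st) (T_{b₁} - T_{b₂})` satisfies `B*B + G*G ≤ 1` and dominates evaluation at 0, and Douglas'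
lemma applies (`exists_apply_eq`). The backward shift restricts to a contraction `X` of H(b) with `X
X* = 1 - v ⊗ v`, where `v = X p = S*b`, and the forward shift is `T = X* + p ⊗ v`
(`exists_backward`, `apply_forward`). Hence `T*T = 1 + (1 + ‖p‖²) v ⊗ v`. With such a rank one
defect, complete hyperexpansivity amounts to `T*v = l v` with `|l| ≤ 1`. Since `T*v = X v + ⟨p, v⟩
v`, this makes `S*b` zero or an eigenvector of the backward shift, which means that `b` has the
stated rational form. In the converse direction the bound `|l| ≤ 1` needs its own argument,
`norm_eigenvalue_le_one`. -/

/-! ### Douglas factorization. -/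

open ContinuousLinearMap InnerProductSpace in
/-- Douglas' lemma, for an injective operator `ι`. -/
theorem exists_comp_eq_of_norm_adjoint_le {E H K : Type*}
    [NormedAddCommGroup E] [InnerProductSpace ℂ E] [CompleteSpace E]
    [NormedAddCommGroup H] [InnerProductSpace ℂ H] [CompleteSpace H]
    [NormedAddCommGroup K] [InnerProductSpace ℂ K] [CompleteSpace K]
    {ι : K →L[ℂ] H} (hd : DenseRange (adjoint ι)) (C : E →L[ℂ] H) (M : ℝ)
    (h : ∀ x, ‖adjoint C x‖ ≤ M * ‖adjoint ι x‖) : ∃ D : E →L[ℂ] K, ι ∘L D = C := by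
  -- By `h`, the map `ι* x ↦ C* x` is well defined and bounded on a dense subspace; the adjoint of
  -- its extension is the factor.
  let D := LinearMap.extendOfNorm (adjoint C : H →ₗ[ℂ] E) (adjoint ι : H →ₗ[ℂ] K)
  have hD : D ∘L adjoint ι = adjoint C := by
    ext x
    exact LinearMap.extendOfNorm_eq (f := (adjoint C : H →ₗ[ℂ] E))
      (e := (adjoint ι : H →ₗ[ℂ] K)) hd ⟨M, h⟩ x
  refine ⟨adjoint D, ?_⟩
  rw [← adjoint_adjoint C, ← hD, adjoint_comp, adjoint_adjoint]

theorem denseRange_adjoint_of_injective {H K : Type*}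
    [NormedAddCommGroup H] [InnerProductSpace ℂ H] [CompleteSpace H]
    [NormedAddCommGroup K] [InnerProductSpace ℂ K] [CompleteSpace K]
    {ι : K →L[ℂ] H} (hι : Function.Injective ι) :
    DenseRange (ContinuousLinearMap.adjoint ι) := by
  have h : (LinearMap.range (ContinuousLinearMap.adjoint ι : H →ₗ[ℂ] K))ᗮ = ⊥ := by
    rw [eq_bot_iff]
    intro x hx
    rw [Submodule.mem_bot]
    apply hι
    rw [map_zero]
    refine ext_inner_left ℂ fun y => ?_
    rw [inner_zero_right, ← ContinuousLinearMap.adjoint_inner_left]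
    exact (Submodule.mem_orthogonal _ _).1 hx _ ⟨y, rfl⟩
  rw [← Submodule.topologicalClosure_eq_top_iff] at h
  have := Submodule.dense_iff_topologicalClosure_eq_top.2 h
  simpa [DenseRange] using! this

namespace ShiftModel

open ContinuousLinearMap InnerProductSpace

/-! ### Forward and backward shifts on an abstract range space. -/

section Intertwining

variable {H K : Type*}
    [NormedAddCommGroup H] [InnerProductSpace ℂ H] [CompleteSpace H]
    [NormedAddCommGroup K] [InnerProductSpace ℂ K] [CompleteSpace K]

theorem eq_of_comp_adjoint_eq {F : Type*} [NormedAddCommGroup F] [InnerProductSpace ℂ F]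
    {ι : K →L[ℂ] H} (hd : DenseRange (adjoint ι))
    {P Q : K →L[ℂ] F} (h : ∀ x, P (adjoint ι x) = Q (adjoint ι x)) : P = Q :=
  ContinuousLinearMap.coeFn_injective <| hd.equalizer P.continuous Q.continuous (funext h)

/-- If `e` is dominated by `G` with `B^*B + G^*G ≤ 1`, then `B e` is in the range of any `ι` with
`ι ι^* = 1 - B B^*`. -/
theorem exists_apply_eq {B G : H →L[ℂ] H} {e : H} {M : ℝ}
    {ι : K →L[ℂ] H} (hd : DenseRange (adjoint ι))
    (hι : ∀ h, ι (adjoint ι h) = h - B (adjoint B h))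
    (hG : ∀ h, ‖B h‖ ^ 2 + ‖G h‖ ^ 2 ≤ ‖h‖ ^ 2) (hM : 0 ≤ M)
    (he : ∀ h, ‖inner ℂ e h‖ ≤ M * ‖G h‖) : ∃ p : K, ι p = B e := by
  have hn : ∀ h, ‖adjoint ι h‖ ^ 2 = ‖h‖ ^ 2 - ‖adjoint B h‖ ^ 2 := by
    intro h
    have h1 : (inner ℂ (adjoint ι h) (adjoint ι h) : ℂ) =
        inner ℂ h h - inner ℂ (adjoint B h) (adjoint B h) := by
      rw [adjoint_inner_left, adjoint_inner_left, hι, inner_sub_right]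
    have h2 := congrArg Complex.re h1
    simpa [← Complex.ofReal_pow, inner_self_eq_norm_sq_to_K] using h2
  obtain ⟨D, hD⟩ := exists_comp_eq_of_norm_adjoint_le hd (toSpanSingleton ℂ (B e)) M <| by
    intro h
    have h1 : adjoint (toSpanSingleton ℂ (B e)) h = inner ℂ e (adjoint B h) := by
      refine ext_inner_left ℂ fun z => ?_
      rw [adjoint_inner_right, adjoint_inner_right]
      simp [inner_smul_left, mul_comm]
    rw [h1]
    refine (he _).trans (mul_le_mul_of_nonneg_left ?_ hM)
    refine le_of_sq_le_sq ?_ (norm_nonneg _)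
    -- With `k = B* h`: `‖G k‖² ≤ ‖k‖² - ‖B k‖²`, and this is at most `‖h‖² - ‖k‖² = ‖ι* h‖²`
    -- because `‖h - B k‖² ≥ 0`.
    have h3 := hG (adjoint B h)
    have h4 : ‖h - B (adjoint B h)‖ ^ 2 =
        ‖h‖ ^ 2 - 2 * ‖adjoint B h‖ ^ 2 + ‖B (adjoint B h)‖ ^ 2 := by
      rw [@norm_sub_sq ℂ, ← adjoint_inner_left, inner_self_eq_norm_sq]
    rw [hn]
    nlinarith [sq_nonneg ‖h - B (adjoint B h)‖]
  exact ⟨D 1, by simpa using congrArg (fun C => C 1) hD⟩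

variable {S B : H →L[ℂ] H} {e : H} {ι : K →L[ℂ] H} {p : K}

/-- The backward shift acts on the range of `ι`, and its defect has rank one. -/
theorem exists_backward (hinj : Function.Injective ι)
    (hS : ∀ h, adjoint S (S h) = h) (hSS : ∀ h, S (adjoint S h) = h - inner ℂ e h • e)
    (hB : ∀ h, B (S h) = S (B h))
    (hι : ∀ h, ι (adjoint ι h) = h - B (adjoint B h)) (hp : ι p = B e) :
    ∃ X : K →L[ℂ] K, (∀ x, ι (X x) = adjoint S (ι x)) ∧
      X * adjoint X = 1 - rankOne ℂ (X p) (X p) := by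
  have hd := denseRange_adjoint_of_injective hinj
  have hB' : ∀ h, adjoint S (adjoint B h) = adjoint B (adjoint S h) := by
    intro h
    refine ext_inner_left ℂ fun z => ?_
    simp only [adjoint_inner_right, hB]
  have hdef : ∀ h, adjoint S (B (adjoint B (S h))) =
      B (adjoint B h) + inner ℂ (adjoint S (B e)) h • adjoint S (B e) := by
    intro h
    -- `B*` commutes with `S*` but with `S` only up to a multiple of `e`: this is the source of
    -- every rank one term below.
    have h1 : adjoint B (S h) = S (adjoint B h) + inner ℂ (adjoint S (B e)) h • e := by
      have h2 := hSS (adjoint B (S h))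
      rw [hB', hS] at h2
      rw [h2, adjoint_inner_left, adjoint_inner_right]
      abel
    rw [h1, map_add, map_add, hB, hS, map_smul, map_smul]
  have hcore : ∀ h, adjoint S (ι (adjoint ι (S h))) =
      ι (adjoint ι h) - inner ℂ (adjoint S (B e)) h • adjoint S (B e) := by
    intro h
    rw [hι, hι, map_sub, hS, hdef]
    abel
  have hadj : adjoint (adjoint S ∘L ι) = adjoint ι ∘L S := by
    rw [adjoint_comp, adjoint_adjoint]
  -- The constant 1 suffices: `‖ι* S h‖² = ‖ι* h‖² - |⟨S* B e, h⟩|²`.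
  obtain ⟨X, hX⟩ := exists_comp_eq_of_norm_adjoint_le hd (adjoint S ∘L ι) 1 <| by
    intro h
    rw [hadj, one_mul]
    refine le_of_sq_le_sq ?_ (norm_nonneg _)
    have h1 : (inner ℂ (adjoint ι (S h)) (adjoint ι (S h)) : ℂ) =
        inner ℂ (adjoint ι h) (adjoint ι h) -
          inner ℂ (adjoint S (B e)) h * inner ℂ h (adjoint S (B e)) := by
      rw [adjoint_inner_left, ← adjoint_inner_right, hcore, inner_sub_right, inner_smul_right,
        adjoint_inner_left ι]
    have h2 := congrArg Complex.re h1
    rw [← inner_conj_symm h, Complex.mul_conj] at h2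
    have h3 := Complex.normSq_nonneg (inner ℂ (adjoint S (B e)) h)
    simp only [inner_self_eq_norm_sq_to_K, Complex.coe_algebraMap, ← Complex.ofReal_pow,
      Complex.sub_re, Complex.ofReal_re] at h2
    simp only [comp_apply]
    linarith
  have hX' : ∀ x, ι (X x) = adjoint S (ι x) := fun x => congrArg (fun C => C x) hX
  have hXa : ∀ h, adjoint X (adjoint ι h) = adjoint ι (S h) := fun h => by
    rw [← hX, adjoint_comp] at hadj
    exact congrArg (fun C => C h) hadj
  refine ⟨X, hX', ?_⟩
  refine eq_of_comp_adjoint_eq hd fun h => hinj ?_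
  simp only [mul_def, one_def, comp_apply, sub_apply, id_apply, rankOne_apply, map_sub, map_smul]
  rw [hX', hXa, hcore, hX', hp, adjoint_inner_right, hX', hp]

/-- The forward shift acts on the range of `ι` by a rank one perturbation of the adjoint of the
backward shift. -/
theorem apply_forward (hinj : Function.Injective ι)
    (hS : ∀ h, adjoint S (S h) = h) (hSS : ∀ h, S (adjoint S h) = h - inner ℂ e h • e)
    (hB : ∀ h, B (S h) = S (B h))
    (hι : ∀ h, ι (adjoint ι h) = h - B (adjoint B h)) (hp : ι p = B e)
    {X : K →L[ℂ] K} (hX : ∀ x, ι (X x) = adjoint S (ι x)) (x : K) :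
    ι ((adjoint X + rankOne ℂ p (X p)) x) = S (ι x) := by
  have hd := denseRange_adjoint_of_injective hinj
  have hXa : ∀ h, adjoint X (adjoint ι h) = adjoint ι (S h) := fun h => by
    refine ext_inner_left ℂ fun z => ?_
    rw [adjoint_inner_right, adjoint_inner_right, adjoint_inner_right, hX, adjoint_inner_left]
  have hB' : ∀ h, adjoint S (adjoint B h) = adjoint B (adjoint S h) := by
    intro h
    refine ext_inner_left ℂ fun z => ?_
    simp only [adjoint_inner_right, hB]
  -- On vectors `ι* h` one has `X* ι* = ι* S`, and `ι ι* S h` falls short of `S ι ι* h` by `⟨S* B e,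
  -- h⟩ B e`, which the rank one term restores.
  suffices ι ∘L (adjoint X + rankOne ℂ p (X p)) = S ∘L ι from congrArg (fun C => C x) this
  refine eq_of_comp_adjoint_eq hd fun h => ?_
  have h1 : adjoint B (S h) = S (adjoint B h) + inner ℂ (adjoint S (B e)) h • e := by
    have h2 := hSS (adjoint B (S h))
    rw [hB', hS] at h2
    rw [h2, adjoint_inner_left, adjoint_inner_right]
    abel
  simp only [comp_apply, add_apply, rankOne_apply, map_add, map_smul]
  rw [hXa, hι, hι, h1, adjoint_inner_right, hX, hp, map_sub, map_add, map_smul, hB]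
  abel

end Intertwining

/-! ### Complete hyperexpansivity for a rank one defect. -/

section Hyperexpansive

variable {K : Type*} [NormedAddCommGroup K] [InnerProductSpace ℂ K] [CompleteSpace K]

/-- `Y ↦ T^* Y T`. -/
noncomputable def conjugation (T : K →L[ℂ] K) : Module.End ℂ (K →L[ℂ] K) :=
  LinearMap.mulLeft ℂ (adjoint T) * LinearMap.mulRight ℂ T

theorem conjugation_apply (T Y : K →L[ℂ] K) : conjugation T Y = adjoint T * Y * T := by
  simp [conjugation, mul_assoc]

theorem conjugation_pow_one (T : K →L[ℂ] K) (n : ℕ) :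
    (conjugation T ^ n) 1 = adjoint T ^ n * T ^ n := by
  induction n with
  | zero => simp
  | succ n ih =>
    rw [pow_succ', Module.End.mul_apply, ih, conjugation_apply, pow_succ' (adjoint T), pow_succ T]
    simp only [mul_assoc]

/-- The binomial theorem in the algebra of linear maps on operators turns the alternating sums into
iterated differences of the identity. -/
theorem sum_eq_pow_conjugation (T : K →L[ℂ] K) (n : ℕ) :
    ∑ i ∈ Finset.range (n + 1),
      ((-1 : ℂ) ^ i * (n.choose i : ℂ)) • ((adjoint T) ^ i * T ^ i) =
      ((1 - conjugation T) ^ n) 1 := by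
  have h : (1 - conjugation T) ^ n = (-conjugation T + 1) ^ n := by rw [neg_add_eq_sub]
  rw [h, (Commute.one_right _).add_pow, LinearMap.sum_apply]
  refine Finset.sum_congr rfl fun i _ => ?_
  have h1 : (-conjugation T) ^ i * 1 ^ (n - i) * (n.choose i : Module.End ℂ (K →L[ℂ] K)) =
      ((-1 : ℂ) ^ i * (n.choose i : ℂ)) • conjugation T ^ i := by
    rw [one_pow, mul_one, ← neg_one_smul ℂ, smul_pow, ← nsmul_eq_mul', mul_comm, mul_smul,
      Nat.cast_smul_eq_nsmul]
  rw [h1, LinearMap.smul_apply, conjugation_pow_one]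

variable {X : K →L[ℂ] K} {p : K}

theorem adjoint_forward (X : K →L[ℂ] K) (p : K) :
    adjoint (adjoint X + rankOne ℂ p (X p)) = X + rankOne ℂ (X p) p := by
  rw [map_add, adjoint_adjoint, adjoint_rankOne]

/-- In the expansion, `X X*` contributes `1 - v ⊗ v`, each of the two cross terms `v ⊗ v`, and the
last term `‖p‖² v ⊗ v`, with `v = X p`. -/
theorem adjoint_mul_forward (hX : X * adjoint X = 1 - rankOne ℂ (X p) (X p)) :
    adjoint (adjoint X + rankOne ℂ p (X p)) * (adjoint X + rankOne ℂ p (X p)) =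
      1 + ((1 + ‖p‖ ^ 2 : ℝ) : ℂ) • rankOne ℂ (X p) (X p) := by
  rw [adjoint_forward]
  ext x
  have h1 : X (adjoint X x) = x - inner ℂ (X p) x • X p := congrArg (fun C => C x) hX
  simp only [mul_def, one_def, comp_apply, add_apply, smul_apply, id_apply, rankOne_apply, map_add,
    map_smul, h1, adjoint_inner_right, inner_self_eq_norm_sq_to_K]
  push_cast
  simp only [Complex.coe_algebraMap]
  module

theorem conjugation_rankOne (T : K →L[ℂ] K) (v : K) :
    conjugation T (rankOne ℂ v v) = rankOne ℂ (adjoint T v) (adjoint T v) := by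
  rw [conjugation_apply]
  ext x
  simp [adjoint_inner_left]

/-- The case `n = 2` says `T*v ⊗ T*v ≤ v ⊗ v`, which already forces the eigenvector condition.
Conversely, `v ⊗ v` is then an eigenvector of `1 - conjugation T` with eigenvalue `1 - |l|² ≥ 0`, so
the `n`-th sum is `-κ (1 - |l|²)ⁿ⁻¹ v ⊗ v`. -/
theorem isCompletelyHyperexpansive_iff_of_adjoint_mul {T : K →L[ℂ] K} {v : K} {κ : ℝ} (hκ : 0 < κ)
    (hT : adjoint T * T = 1 + (κ : ℂ) • rankOne ℂ v v) :
    IsCompletelyHyperexpansive T ↔ ∃ l : ℂ, ‖l‖ ≤ 1 ∧ adjoint T v = l • v := by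
  have h1 : ((1 - conjugation T)) 1 = -((κ : ℂ) • rankOne ℂ v v) := by
    rw [LinearMap.sub_apply, conjugation_apply, mul_one, hT, Module.End.one_apply]
    abel
  simp only [IsCompletelyHyperexpansive, sum_eq_pow_conjugation]
  constructor
  · intro h
    have h2 := h 2 (by norm_num)
    rw [pow_two, Module.End.mul_apply, h1, map_neg, map_smul, LinearMap.sub_apply,
      conjugation_rankOne, Module.End.one_apply, ← sub_nonneg, nonneg_iff_isPositive] at h2
    have h3 : ∀ x, ‖inner ℂ (adjoint T v) x‖ ^ 2 ≤ ‖inner ℂ v x‖ ^ 2 := by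
      intro x
      have h4 := h2.re_inner_nonneg_right x
      have h5 : (inner ℂ x ((0 - -((κ : ℂ) • (rankOne ℂ v v -
          rankOne ℂ (adjoint T v) (adjoint T v)))) x) : ℂ) =
          ((κ * (‖inner ℂ v x‖ ^ 2 - ‖inner ℂ (adjoint T v) x‖ ^ 2) : ℝ) : ℂ) := by
        have h6 : ∀ w : K, (inner ℂ w x * inner ℂ x w : ℂ) = ((‖inner ℂ w x‖ ^ 2 : ℝ) : ℂ) := by
          intro w
          rw [← inner_conj_symm x w, Complex.mul_conj, Complex.normSq_eq_norm_sq]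
        simp only [zero_sub, neg_neg, smul_apply, sub_apply, rankOne_apply, inner_smul_right,
          inner_sub_right, h6]
        push_cast
        rfl
      rw [h5] at h4
      have h7 : 0 ≤ κ * (‖inner ℂ v x‖ ^ 2 - ‖inner ℂ (adjoint T v) x‖ ^ 2) := by
          rwa [RCLike.re_eq_complex_re, Complex.ofReal_re] at h4
      linarith [nonneg_of_mul_nonneg_right h7 hκ]
    by_cases hv : v = 0
    · exact ⟨0, by simp, by simp [hv]⟩
    -- Split off the component `w` of `T*v` orthogonal to `v`. Testing `h3` on `w` gives `w = 0`;
    -- testing it on `v` gives `|l| ≤ 1`.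
    obtain ⟨l, w, hlw, hw⟩ : ∃ (l : ℂ) (w : K), adjoint T v = l • v + w ∧ inner ℂ v w = 0 := by
      refine ⟨inner ℂ v (adjoint T v) / inner ℂ v v, _, (add_sub_cancel _ _).symm, ?_⟩
      rw [inner_sub_right, inner_smul_right, div_mul_cancel₀ _ (inner_self_ne_zero.2 hv), sub_self]
    have hw0 : w = 0 := by
      have h8 := h3 w
      rw [hlw, inner_add_left, inner_smul_left, hw, mul_zero, zero_add, norm_zero] at h8
      have h9 : ‖(inner ℂ w w : ℂ)‖ = 0 := by nlinarith [norm_nonneg (inner ℂ w w : ℂ)]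
      exact inner_self_eq_zero.1 (norm_eq_zero.1 h9)
    rw [hw0, add_zero] at hlw
    refine ⟨l, ?_, hlw⟩
    have h8 := h3 v
    have h9 : 0 < ‖(inner ℂ v v : ℂ)‖ := norm_pos_iff.2 (inner_self_ne_zero.2 hv)
    rw [hlw, inner_smul_left, norm_mul, RCLike.norm_conj] at h8
    have h10 := le_of_sq_le_sq h8 h9.le
    exact le_of_mul_le_mul_right (by simpa using h10) h9
  · rintro ⟨l, hl, hlv⟩ n hn
    obtain ⟨m, rfl⟩ := Nat.exists_eq_add_of_le' hn
    have h2 : (1 - conjugation T) (rankOne ℂ v v) =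
        ((1 - ‖l‖ ^ 2 : ℝ) : ℂ) • rankOne ℂ v v := by
      rw [LinearMap.sub_apply, conjugation_rankOne, hlv, Module.End.one_apply]
      ext x
      have h6 : (l * starRingEnd ℂ l : ℂ) = ((‖l‖ ^ 2 : ℝ) : ℂ) := by
        rw [Complex.mul_conj, Complex.normSq_eq_norm_sq]
      simp only [sub_apply, smul_apply, rankOne_apply, inner_smul_left, smul_smul]
      rw [Complex.ofReal_sub, ← h6, ← sub_smul]
      congr 1
      push_cast
      ring
    have h3 : ∀ k : ℕ, ((1 - conjugation T) ^ k) (rankOne ℂ v v) =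
        (((1 - ‖l‖ ^ 2) ^ k : ℝ) : ℂ) • rankOne ℂ v v := by
      intro k
      induction k with
      | zero => simp
      | succ k ih =>
        rw [pow_succ, Module.End.mul_apply, h2, map_smul, ih, smul_smul, ← Complex.ofReal_mul,
          ← pow_succ']
    rw [pow_succ, Module.End.mul_apply, h1, map_neg, map_smul, h3, smul_smul, ← Complex.ofReal_mul,
      neg_nonpos, nonneg_iff_isPositive]
    have h4 : 0 ≤ κ * (1 - ‖l‖ ^ 2) ^ m :=
      mul_nonneg hκ.le (pow_nonneg (by nlinarith [norm_nonneg l]) _)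
    exact (isPositive_rankOne_self v).smul_of_nonneg (by exact_mod_cast h4)

/-- If `|l| > 1`, the range of `1 - s T` with `s = 1 / conj l` is orthogonal to `v = X p`. The
resolvent of `X*` shows that this range contains a nonzero multiple of `p`, so `⟨p, v⟩ = 0`. Then
`T*v = X v`, so `l = μ`, which is impossible. -/
theorem norm_eigenvalue_le_one (hX : X * adjoint X = 1 - rankOne ℂ (X p) (X p))
    (hinj : ∀ (s : ℂ) (x : K), s • (adjoint X + rankOne ℂ p (X p)) x = x → x = 0)
    {l μ : ℂ} (hμ : ‖μ‖ ≤ 1) (hμv : X (X p) = μ • X p) (hv : X p ≠ 0)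
    (hl : adjoint (adjoint X + rankOne ℂ p (X p)) (X p) = l • X p) : ‖l‖ ≤ 1 := by
  by_contra! hl1
  have hlne : l ≠ 0 := by rintro rfl; simp at hl1; linarith
  have hXn : ‖adjoint X‖ ≤ 1 := by
    refine opNorm_le_bound _ zero_le_one fun x => ?_
    rw [one_mul]
    refine le_of_sq_le_sq ?_ (norm_nonneg _)
    have h1 : (inner ℂ (adjoint X x) (adjoint X x) : ℂ) =
        inner ℂ x x - inner ℂ (X p) x * inner ℂ x (X p) := by
      have h0 : X (adjoint X x) = x - inner ℂ (X p) x • X p := congrArg (fun C => C x) hX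
      rw [adjoint_inner_left, h0, inner_sub_right, inner_smul_right]
    have h2 := congrArg Complex.re h1
    rw [← inner_conj_symm x (X p), Complex.mul_conj] at h2
    have h3 := Complex.normSq_nonneg (inner ℂ (X p) x)
    simp only [inner_self_eq_norm_sq_to_K, Complex.coe_algebraMap, ← Complex.ofReal_pow,
      Complex.sub_re, Complex.ofReal_re] at h2
    linarith
  set s : ℂ := (starRingEnd ℂ l)⁻¹ with hs
  have hsl : s * starRingEnd ℂ l = 1 := inv_mul_cancel₀ (by simpa using hlne)
  have hsn : ‖s‖ < 1 := by
    rw [hs, norm_inv, RCLike.norm_conj]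
    exact inv_lt_one_of_one_lt₀ hl1
  have hu : IsUnit (1 - s • adjoint X) := by
    refine isUnit_one_sub_of_norm_lt_one ?_
    rw [norm_smul]
    nlinarith [norm_nonneg s, norm_nonneg (adjoint X)]
  obtain ⟨Y, hY⟩ := hu.exists_right_inv
  -- `Y p` is `(1 - s X*)⁻¹ p`; as `T` differs from `X*` by a rank one operator with range in the
  -- span of `p`, `1 - s T` sends it to `c p`.
  have hYp : Y p - s • adjoint X (Y p) = p := by simpa using congrArg (fun C => C p) hY
  set c : ℂ := 1 - s * inner ℂ (X p) (Y p) with hc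
  have hres : Y p - s • (adjoint X + rankOne ℂ p (X p)) (Y p) = c • p := by
    simp only [add_apply, rankOne_apply, smul_add, hc, sub_smul, one_smul, mul_smul]
    rw [← sub_sub, hYp]
  have hpair : (inner ℂ (X p) (Y p - s • (adjoint X + rankOne ℂ p (X p)) (Y p)) : ℂ) = 0 := by
    rw [inner_sub_right, inner_smul_right, ← adjoint_inner_left (adjoint X + _), hl, inner_smul_left, ← mul_assoc,
      hsl, one_mul, sub_self]
  rw [hres, inner_smul_right] at hpair
  have hp0 : p ≠ 0 := by rintro rfl; simp at hv
  have hc0 : c ≠ 0 := by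
    intro h0
    rw [h0, zero_smul, sub_eq_zero] at hres
    have := hinj s _ hres.symm
    rw [this] at hYp
    simp at hYp
    exact hp0 hYp.symm
  have hin : (inner ℂ (X p) p : ℂ) = 0 := (mul_eq_zero.1 hpair).resolve_left hc0
  have hin' : (inner ℂ p (X p) : ℂ) = 0 := by rw [← inner_conj_symm, hin, map_zero]
  rw [adjoint_forward] at hl
  simp only [add_apply, rankOne_apply, hin', zero_smul, add_zero, hμv] at hl
  have : μ = l := smul_left_injective ℂ hv hl
  rw [this] at hμ
  linarith

end Hyperexpansive

end ShiftModel

/-! ### The shift on H², non-extreme symbols and rational symbols. -/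

namespace HardySpace

open ContinuousLinearMap

/-- Multiplication by `z` on `H²`, as an isometry. -/
noncomputable def shiftIsometry : HardySpace →ₗᵢ[ℂ] HardySpace where
  toFun f := ⟨fun n => Nat.casesOn n 0 fun m => f m, memℓp_gen <| by
    refine (summable_nat_add_iff 1).1 ?_
    simpa using (hasSum_sq f).summable⟩
  map_add' f g := by
    ext n
    cases n
    · exact (add_zero (0 : ℂ)).symm
    · rfl
  map_smul' c f := by
    ext n
    cases n <;> simp
  norm_map' f := by
    refine (sq_eq_sq₀ (norm_nonneg _) (norm_nonneg _)).1 ?_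
    refine HasSum.unique (hasSum_sq _) ?_
    refine (hasSum_nat_add_iff' 1).1 ?_
    simpa using hasSum_sq f

/-- Multiplication by `z` on `H²`. -/
noncomputable def shift : HardySpace →L[ℂ] HardySpace := shiftIsometry.toContinuousLinearMap

@[simp] theorem shift_zero (f : HardySpace) : shift f 0 = 0 := rfl

@[simp] theorem shift_succ (f : HardySpace) (n : ℕ) : shift f (n + 1) = f n := rfl

theorem hasSum_toFun (f : HardySpace) (z : 𝔻) :
    HasSum (fun n => f n * (z : ℂ) ^ n) (f.toFun z) := by
  refine Summable.hasSum (Summable.of_norm ?_)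
  simpa only [norm_mul, norm_pow] using summable_norm_toFun f (norm_nonneg _) z.norm_lt_one

theorem toFun_shift (f : HardySpace) (z : 𝔻) : (shift f).toFun z = z * f.toFun z := by
  refine HasSum.unique (hasSum_toFun _ z) ?_
  refine (hasSum_nat_add_iff' 1).1 ?_
  simpa [pow_succ', mul_left_comm] using (hasSum_toFun f z).mul_left (z : ℂ)

theorem adjoint_shift_shift (f : HardySpace) : adjoint shift (shift f) = f := by
  refine ext_inner_left ℂ fun g => ?_
  rw [adjoint_inner_right]
  exact shiftIsometry.inner_map_map g f

/-- The constant function `1`. -/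
noncomputable def constOne : HardySpace := lp.single 2 0 1

theorem toFun_constOne (z : 𝔻) : constOne.toFun z = 1 := by
  refine (tsum_eq_single 0 fun n hn => ?_).trans ?_
  · simp [constOne, Pi.single_eq_of_ne hn]
  · simp [constOne]

theorem inner_constOne_left (f : HardySpace) : inner ℂ constOne f = f 0 := by
  simp [constOne, lp.inner_single_left]

theorem adjoint_shift_apply (f : HardySpace) (n : ℕ) : adjoint shift f n = f (n + 1) := by
  have h1 : shift (lp.single 2 n 1) = lp.single 2 (n + 1) 1 := by
    ext m
    cases m with
    | zero => simp [lp.single_apply]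
    | succ m => by_cases h : m = n <;> simp [lp.single_apply, h]
  have h2 : (inner ℂ (lp.single 2 n 1 : HardySpace) (adjoint shift f) : ℂ) =
      inner ℂ (lp.single 2 (n + 1) 1 : HardySpace) f := by
    rw [adjoint_inner_right, h1]
  simpa [lp.inner_single_left] using h2

theorem adjoint_shift_constOne : adjoint shift constOne = 0 := by
  ext n
  simp [adjoint_shift_apply, constOne]

theorem shift_adjoint_shift (f : HardySpace) :
    shift (adjoint shift f) = f - inner ℂ constOne f • constOne := by
  rw [inner_constOne_left]
  ext n
  cases n with
  | zero =>
    simp only [shift_zero, lp.coeFn_sub, lp.coeFn_smul, Pi.sub_apply, Pi.smul_apply]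
    simp [constOne]
  | succ n =>
    simp only [shift_succ, adjoint_shift_apply, lp.coeFn_sub, lp.coeFn_smul, Pi.sub_apply,
      Pi.smul_apply]
    simp [constOne]

theorem toFun_eq_add_mul (f : HardySpace) (z : 𝔻) :
    f.toFun z = f 0 + z * (adjoint shift f).toFun z := by
  have h : f = f 0 • constOne + shift (adjoint shift f) := by
    rw [shift_adjoint_shift, inner_constOne_left]
    abel
  conv_lhs => rw [h]
  rw [toFun_add, toFun_smul, Pi.add_apply, Pi.smul_apply, toFun_shift, toFun_constOne]
  simp

/-- A nonzero operator commuting with the shift dominates evaluation at the origin. -/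
theorem exists_norm_inner_constOne_le {G : HardySpace →L[ℂ] HardySpace}
    (hG : ∀ f, G (shift f) = shift (G f)) (hG0 : G ≠ 0) :
    ∃ M : ℝ, 0 ≤ M ∧ ∀ f, ‖inner ℂ constOne f‖ ≤ M * ‖G f‖ := by
  classical
  have hex : ∃ k, ∃ f, G f k ≠ 0 := by
    by_contra! h
    exact hG0 (by ext f k; simpa using h k f)
  -- `k` is the least order of vanishing at 0 in the range of `G`. As `G` commutes with the shift,
  -- coefficient `k` of `G f` sees only `f 0`.
  set k := Nat.find hex with hk
  obtain ⟨f₁, hf₁⟩ := Nat.find_spec hex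
  have hmin : ∀ j < k, ∀ f, G f j = 0 := fun j hj f => by
    by_contra h
    exact Nat.find_min hex hj ⟨f, h⟩
  have hcoef : ∀ f, G f k = f 0 * G constOne k := by
    intro f
    have h1 : f = f 0 • constOne + shift (adjoint shift f) := by
      rw [shift_adjoint_shift, inner_constOne_left]
      abel
    have h2 : shift (G (adjoint shift f)) k = 0 := by
      rcases hkk : k with _ | j
      · simp
      · rw [shift_succ]
        exact hmin j (by omega) _
    conv_lhs => rw [h1]
    rw [map_add, hG, map_smul, lp.coeFn_add, Pi.add_apply, h2, add_zero, lp.coeFn_smul,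
      Pi.smul_apply, smul_eq_mul]
  have hne : G constOne k ≠ 0 := by
    intro h
    apply hf₁
    rw [← hk, hcoef, h, mul_zero]
  have hpos := norm_pos_iff.2 hne
  refine ⟨‖G constOne k‖⁻¹, by positivity, fun f => ?_⟩
  rw [inner_constOne_left, le_inv_mul_iff₀ hpos, mul_comm, ← norm_mul, ← hcoef]
  exact lp.norm_apply_le_norm (by norm_num) _ _

theorem toeplitz_shift {b : 𝔻 → ℂ} (hb : b ∈ hardyInftyUnitBall) (f : HardySpace) :
    toeplitz hb (shift f) = shift (toeplitz hb f) := by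
  refine toFun_injective (funext fun z => ?_)
  rw [toeplitz_toFun, toFun_shift, toFun_shift, toeplitz_toFun, mul_left_comm]

theorem norm_toeplitz_apply_le {b : 𝔻 → ℂ} (hb : b ∈ hardyInftyUnitBall) (f : HardySpace) :
    ‖toeplitz hb f‖ ≤ ‖f‖ :=
  ((toeplitz hb).le_of_opNorm_le (norm_toeplitz_le hb) f).trans_eq (one_mul _)

theorem toFun_toeplitz_constOne {b : 𝔻 → ℂ} (hb : b ∈ hardyInftyUnitBall) (z : 𝔻) :
    (toeplitz hb constOne).toFun z = b z := by
  rw [toeplitz_toFun, toFun_constOne, mul_one]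

/-- A non-extreme `b` is the first entry of a contractive column `(T_b, G)` with `G ≠ 0`. -/
theorem exists_contractive_column {b : 𝔻 → ℂ} (hb : b ∈ hardyInftyUnitBall)
    (hne : b ∉ Set.extremePoints ℝ hardyInftyUnitBall) :
    ∃ G : HardySpace →L[ℂ] HardySpace, (∀ f, G (shift f) = shift (G f)) ∧ G ≠ 0 ∧
      ∀ f, ‖toeplitz hb f‖ ^ 2 + ‖G f‖ ^ 2 ≤ ‖f‖ ^ 2 := by
  rw [mem_extremePoints_iff_left] at hne
  push Not at hne
  obtain ⟨b₁, hb₁, b₂, hb₂, ⟨s, t, hs, ht, hst, hbst⟩, hbne⟩ := hne hb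
  have hb12 : b₁ ≠ b₂ := by
    rintro rfl
    exact hbne (by rw [← hbst, ← add_smul, hst, one_smul])
  have hcomb : ∀ f, toeplitz hb f = (s : ℂ) • toeplitz hb₁ f + (t : ℂ) • toeplitz hb₂ f := by
    intro f
    refine toFun_injective (funext fun z => ?_)
    rw [toFun_add, toFun_smul, toFun_smul, Pi.add_apply, Pi.smul_apply, Pi.smul_apply,
      toeplitz_toFun, toeplitz_toFun, toeplitz_toFun, ← hbst]
    simp only [Pi.add_apply, Pi.smul_apply, Complex.real_smul, smul_eq_mul]
    ring
  have hstpos : 0 < s * t := mul_pos hs ht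
  -- The weight comes from `‖s x + t y‖² + s t ‖x - y‖² = s ‖x‖² + t ‖y‖²`, valid for `s + t = 1`.
  refine ⟨(Real.sqrt (s * t) : ℂ) • (toeplitz hb₁ - toeplitz hb₂), fun f => ?_, fun h => ?_,
    fun f => ?_⟩
  · rw [smul_apply, smul_apply, sub_apply, sub_apply, toeplitz_shift, toeplitz_shift, map_smul,
      map_sub]
  · have h0 : toeplitz hb₁ - toeplitz hb₂ = 0 := (smul_eq_zero.1 h).resolve_left
      (by exact_mod_cast (Real.sqrt_pos.2 hstpos).ne')
    refine hb12 (funext fun z => ?_)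
    rw [← toFun_toeplitz_constOne hb₁, ← toFun_toeplitz_constOne hb₂, sub_eq_zero.1 h0]
  · have h1 := norm_toeplitz_apply_le hb₁ f
    have h2 := norm_toeplitz_apply_le hb₂ f
    set x := toeplitz hb₁ f
    set y := toeplitz hb₂ f
    have hG : ‖((Real.sqrt (s * t) : ℂ) • (toeplitz hb₁ - toeplitz hb₂)) f‖ ^ 2 =
        s * t * ‖x - y‖ ^ 2 := by
      rw [smul_apply, sub_apply, norm_smul, mul_pow, Complex.norm_real,
        Real.norm_of_nonneg (Real.sqrt_nonneg _), Real.sq_sqrt hstpos.le]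
    have hadd : ‖(s : ℂ) • x + (t : ℂ) • y‖ ^ 2 =
        s ^ 2 * ‖x‖ ^ 2 + 2 * (s * t * RCLike.re (inner ℂ x y)) + t ^ 2 * ‖y‖ ^ 2 := by
      rw [@norm_add_sq ℂ, norm_smul, norm_smul, mul_pow, mul_pow, Complex.norm_real,
        Complex.norm_real, Real.norm_of_nonneg hs.le, Real.norm_of_nonneg ht.le,
        inner_smul_left, inner_smul_right]
      simp [mul_assoc]
    rw [hG, hcomb, hadd, @norm_sub_sq ℂ]
    have h3 := pow_le_pow_left₀ (norm_nonneg _) h1 2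
    have h4 := pow_le_pow_left₀ (norm_nonneg _) h2 2
    obtain rfl : t = 1 - s := by linarith
    nlinarith

/-- `b` is a Möbius-type rational function exactly when the backward shift scales `S^* b`. -/
theorem exists_rational_iff {b : 𝔻 → ℂ} {f : HardySpace} (hf : ∀ z, f.toFun z = b z) :
    (∃ c γ β : ℂ, ‖β‖ < 1 ∧ ∀ z : 𝔻, b z = (c + γ * (z : ℂ)) / (1 - β * (z : ℂ))) ↔
      ∃ μ : ℂ, ‖μ‖ < 1 ∧ adjoint shift (adjoint shift f) = μ • adjoint shift f := by
  have hden : ∀ (β : ℂ) (z : 𝔻), ‖β‖ ≤ 1 → 1 - β * (z : ℂ) ≠ 0 := by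
    intro β z hβ h
    have h1 : ‖β * (z : ℂ)‖ = 1 := by rw [← sub_eq_zero.1 h, norm_one]
    rw [norm_mul] at h1
    nlinarith [z.norm_lt_one, norm_nonneg (z : ℂ)]
  constructor
  · rintro ⟨c, γ, β, hβ, hbz⟩
    refine ⟨β, hβ, ?_⟩
    -- This is `(1 - β z) b = c + γ z`; two backward shifts annihilate the right side.
    have h1 : f = β • shift f + (c • constOne + γ • shift constOne) := by
      refine toFun_injective (funext fun z => ?_)
      simp only [toFun_add, toFun_smul, Pi.add_apply, Pi.smul_apply, toFun_shift, toFun_constOne,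
        hf, hbz, smul_eq_mul]
      linear_combination div_mul_cancel₀ (c + γ * (z : ℂ)) (hden β z hβ.le)
    conv_lhs => rw [h1]
    simp only [map_add, map_smul, adjoint_shift_shift, adjoint_shift_constOne, map_zero, smul_zero,
      add_zero]
  · rintro ⟨μ, hμ, h⟩
    -- Obtained by eliminating `g = S* f` from `f = f 0 + z g` and `g = f 1 + μ z g`.
    refine ⟨f 0, f 1 - μ * f 0, μ, hμ, fun z => ?_⟩
    have h1 := toFun_eq_add_mul f z
    have h2 := toFun_eq_add_mul (adjoint shift f) z
    rw [h, toFun_smul, Pi.smul_apply, smul_eq_mul, adjoint_shift_apply, zero_add] at h2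
    rw [← hf, eq_div_iff (hden μ z hμ.le)]
    linear_combination (1 - μ * z) * h1 + z * h2

/-- Eigenvalues of the backward shift lie in the open disc. -/
theorem norm_lt_one_of_adjoint_shift_eq {f : HardySpace} (hf : f ≠ 0) {μ : ℂ}
    (h : adjoint shift f = μ • f) : ‖μ‖ < 1 := by
  -- The Taylor coefficients are geometric, hence square summable with `f 0 ≠ 0` only for `|μ| < 1`.
  have h1 : ∀ n, f n = f 0 * μ ^ n := by
    intro n
    induction n with
    | zero => simp
    | succ n ih =>
      rw [← adjoint_shift_apply, h, lp.coeFn_smul, Pi.smul_apply, smul_eq_mul, ih]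
      ring
  have h0 : f 0 ≠ 0 := by
    intro h0
    exact hf (by ext n; simp [h1 n, h0])
  have h2 : Summable fun n => ‖f 0‖ ^ 2 * (‖μ‖ ^ 2) ^ n := (hasSum_sq f).summable.congr fun n => by
    rw [h1 n, norm_mul, norm_pow, mul_pow, pow_right_comm]
  rw [summable_mul_left_iff (by simpa using h0)] at h2
  rw [summable_geometric_iff_norm_lt_one] at h2
  rw [Real.norm_of_nonneg (by positivity)] at h2
  nlinarith [norm_nonneg μ]

end HardySpace

/-! ### The inclusion of a range space. -/

namespace RangeSpace

open ContinuousLinearMap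

variable {E : Type*} [NormedAddCommGroup E] [InnerProductSpace ℂ E] [CompleteSpace E]

/-- The inclusion of the range space of `A`, as a bounded operator. -/
noncomputable def valL (A : E →L[ℂ] E) : RangeSpace A →L[ℂ] E :=
  LinearMap.mkContinuous
    { toFun := val
      map_add' := fun _ _ => rfl
      map_smul' := fun _ _ => rfl }
    ‖A‖ fun x => by
      change ‖x.val‖ ≤ ‖A‖ * ‖(lift A x : E)‖
      rw [← apply_lift]
      exact A.le_opNorm _

theorem valL_apply (A : E →L[ℂ] E) (x : RangeSpace A) : valL A x = x.val := rfl

theorem valL_injective (A : E →L[ℂ] E) : Function.Injective (valL A) :=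
  fun _ _ h => Subtype.val_injective h

/-- `A* h` is orthogonal to `ker A`, so it is the lift of the adjoint of the inclusion at `h`. For
the defect root this yields `ι ι* = 1 - B B*`. -/
theorem valL_adjoint_valL (A : E →L[ℂ] E) (h : E) :
    valL A (adjoint (valL A) h) = A (adjoint A h) := by
  have hker : adjoint A h ∈ (LinearMap.ker (A : E →ₗ[ℂ] E))ᗮ := by
    intro x hx
    rw [adjoint_inner_right, show A x = 0 from hx, inner_zero_left]
  have h1 : adjoint (valL A) h = (lift A).symm ⟨adjoint A h, hker⟩ := by
    refine ext_inner_left ℂ fun x => ?_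
    rw [adjoint_inner_right, valL_apply, ← apply_lift, ← adjoint_inner_right, inner_eq,
      LinearEquiv.apply_symm_apply]
  rw [h1, valL_apply, ← apply_lift, LinearEquiv.apply_symm_apply]

end RangeSpace

/-! ### The theorem for H(b). -/

open HardySpace ContinuousLinearMap InnerProductSpace ShiftModel in
theorem proposition3p1 (b : 𝔻 → ℂ) (hb : b ∈ hardyInftyUnitBall)
    (hne : b ∉ Set.extremePoints ℝ hardyInftyUnitBall) :
    ∃ T : DeBrangesRovnyak hb →L[ℂ] DeBrangesRovnyak hb,
      (∀ (f : DeBrangesRovnyak hb) (z : 𝔻), (T f).val.toFun z = (z : ℂ) * f.val.toFun z) ∧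
      (IsCompletelyHyperexpansive T ↔
        ∃ c γ β : ℂ, ‖β‖ < 1 ∧ ∀ z : 𝔻, b z = (c + γ * (z : ℂ)) / (1 - β * (z : ℂ))) := by
  obtain ⟨hA0, hAA⟩ := defectRoot_spec (norm_toeplitz_le hb)
  set A := defectRoot (toeplitz hb)
  have hAsa : adjoint A = A := ((nonneg_iff_isPositive A).1 hA0).isSelfAdjoint
  set ι := RangeSpace.valL A
  have hinj : Function.Injective ι := RangeSpace.valL_injective A
  have hι : ∀ h, ι (adjoint ι h) = h - toeplitz hb (adjoint (toeplitz hb) h) := fun h => by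
    rw [RangeSpace.valL_adjoint_valL, hAsa]
    exact congrArg (fun C => C h) hAA
  have hB := toeplitz_shift hb
  obtain ⟨G, hGS, hG0, hG⟩ := exists_contractive_column hb hne
  obtain ⟨M, hM, hGM⟩ := exists_norm_inner_constOne_le hGS hG0
  -- `p` is `b` regarded as an element of H(b), since `T_b 1 = b`.
  obtain ⟨p, hp⟩ := exists_apply_eq (denseRange_adjoint_of_injective hinj) hι hG hM hGM
  obtain ⟨X, hX, hXX⟩ :=
    exists_backward hinj adjoint_shift_shift shift_adjoint_shift hB hι hp
  have hT := apply_forward hinj adjoint_shift_shift shift_adjoint_shift hB hι hp hX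
  refine ⟨adjoint X + rankOne ℂ p (X p), fun f z => ?_, ?_⟩
  · rw [← RangeSpace.valL_apply, hT, toFun_shift]
    rfl
  rw [isCompletelyHyperexpansive_iff_of_adjoint_mul (by positivity) (adjoint_mul_forward hXX),
    exists_rational_iff (toFun_toeplitz_constOne hb), ← hp]
  have hv : ι (X p) = adjoint shift (ι p) := hX p
  have hTv : adjoint (adjoint X + rankOne ℂ p (X p)) (X p) =
      X (X p) + (inner ℂ p (X p) : ℂ) • X p := by
    rw [adjoint_forward]
    rfl
  constructor
  · rintro ⟨l, -, hl⟩
    -- This is the case of constant `b`, where any `μ` in the disc would do.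
    by_cases hv0 : X p = 0
    · exact ⟨0, by simp, by rw [← hv, hv0]; simp⟩
    -- The eigenvalues of `T*` and of the backward shift at `v` differ by `⟨p, v⟩`.
    have h1 : X (X p) = (l - inner ℂ p (X p)) • X p := by
      rw [sub_smul, ← hl, hTv, add_sub_cancel_right]
    have h2 : adjoint shift (ι (X p)) = (l - inner ℂ p (X p)) • ι (X p) := by
      rw [← hX, ← map_smul, ← h1]
    refine ⟨l - inner ℂ p (X p), norm_lt_one_of_adjoint_shift_eq (f := ι (X p)) ?_ h2, ?_⟩
    · exact fun h => hv0 (hinj (by rw [h, map_zero]))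
    · rw [← hv, h2]
  · rintro ⟨μ, hμ, h⟩
    have h1 : X (X p) = μ • X p := hinj (by rw [map_smul, hX, hv, h])
    by_cases hv0 : X p = 0
    · exact ⟨0, by simp, by simp [hv0]⟩
    have hl : adjoint (adjoint X + rankOne ℂ p (X p)) (X p) = (μ + inner ℂ p (X p)) • X p := by
      rw [hTv, h1, add_smul]
    refine ⟨_, norm_eigenvalue_le_one hXX (fun s x hx => ?_) hμ.le h1 hv0 hl, hl⟩
    -- The relation `f = s z f` kills the Taylor coefficients of `f` one after another.
    have h2 : ι x = s • shift (ι x) := by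
      rw [← hT, ← map_smul, hx]
    have h3 : ∀ n, ι x n = 0 := by
      intro n
      induction n with
      | zero => rw [h2]; simp
      | succ n ih => rw [h2]; simp [ih]
    exact hinj (by rw [map_zero]; ext n; simpa using h3 n)
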